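/- All vector spaces are over $\mathbb{C}$. Let $\mathfrak{g}=\mathfrak{g}_{\bar 0}\oplus\mathfrak{g}_{\bar 1}$ be a finite-dimensional simple Lie superalgebra (non-abelian, with no graded ideals other than $0$ and $\mathfrak{g}$), let $A$ be a finitely generated associative commutative $\mathbb{C}$-algebra with unit, and let $\Gamma$ be a finite abelian group acting on $\mathfrak{g}$ by (even) Lie superalgebra automorphisms and on $A$ by $\mathbb{C}$-algebra automorphisms, such that the induced action of $\Gamma$ on the set of maximal ideals of $A$ is free. Let $(\mathfrak{g}\otimes A)^\Gamma$ be the Lie superalgebra of $\Gamma$-fixed points of $\mathfrak{g}\otimes A$, where $(\mathfrak{g}\otimes A)_z=\mathfrak{g}_z\otimes A$, $[x\otimes a,y\otimes b]=[x,y]\otimes ab$ and $\gamma(x\otimes a)=\gamma x\otimes\gamma a$. For modules $V,U$ (that is, $\mathbb{Z}_2$-graded modules) over a Lie superalgebra $L$, let $\operatorname{Ext}^1_L(V,U)=\ker d^1/\operatorname{im} d^0$ be the first cohomology of the Chevalley–Eilenberg cocomplex $$\operatorname{Hom}_{\mathbb{C}}(V,U)\xrightarrow{d^0}\operatorname{Hom}_{\mathbb{C}}(L\otimes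 V,U)\xrightarrow{d^1}\operatorname{Hom}_{\mathbb{C}}(\Lambda^2L\otimes V,U),$$ where $\Lambda^2$ is the exterior square in the super sense, all linear maps (even and odd) are allowed, and, for homogeneous $m$, $f$, $x$, $y$ and $v\in V$, writing $f(x)v=f(x\otimes v)$, $$(d^0m)(x)v=(-1)^{|x||m|}\,x\,m(v)-m(xv),$$ $$\begin{aligned}(d^1f)(x,y)v={}&\bigl((-1)^{|x||f|}\,x\,f(y)v-(-1)^{|x||y|}f(y)\,xv\bigr)\\&-\bigl((-1)^{|y|(|x|+|f|)}\,y\,f(x)v-f(x)\,yv\bigr)-f([x,y])v.\end{aligned}$$ If $V$ and $V'$ are finite-dimensional irreducible $(\mathfrak{g}\otimes A)^\Gamma$-modules (nonzero, with no graded submodules other than $0$ and the whole module), then the vector space $\operatorname{Ext}^1_{(\mathfrak{g}\otimes A)^\Gamma}(V,V')$ is finite-dimensional. -/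

import Mathlib

set_option maxSynthPendingDepth 3

open scoped TensorProduct

noncomputable section

/-- A structure of complex super space on `V`: a `ℤ/2`-grading `V = V₀ ⊕ V₁`. -/
class SuperSpace (V : Type*) [AddCommGroup V] [Module ℂ V] where
  gr : ZMod 2 → Submodule ℂ V
  isCompl : IsCompl (gr 0) (gr 1)

/-- The sign `(-1)^(ij)` of the rule of signs, for parities `i, j`. -/
def superSign (i j : ZMod 2) : ℂ := (-1) ^ (i.val * j.val)

namespace SuperSpace

lemma parity_cases (z : ZMod 2) : z = 0 ∨ z = 1 := by
  revert z; decide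

@[simp] lemma parity_one_add_one : (1 + 1 : ZMod 2) = 0 := by decide

@[simp] lemma sign_zero_left (j : ZMod 2) : superSign 0 j = 1 := by simp [superSign]

@[simp] lemma sign_zero_right (i : ZMod 2) : superSign i 0 = 1 := by simp [superSign]

@[simp] lemma sign_one_one : superSign 1 1 = -1 := by
  have h : (1 : ZMod 2).val = 1 := by decide
  simp [superSign, h]

section

variable {V : Type*} [AddCommGroup V] [Module ℂ V] [SuperSpace V]

/-- The projection of a super space onto its homogeneous component of parity `z`, along the
other component. -/
def proj (z : ZMod 2) : V →ₗ[ℂ] V :=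
  if z = 0 then Submodule.projection (gr 0) (gr 1) isCompl
  else Submodule.projection (gr 1) (gr 0) isCompl.symm

lemma proj_mem (z : ZMod 2) (v : V) : proj z v ∈ gr (V := V) z := by
  rcases parity_cases z with rfl | rfl
  · simp [proj]
  · simp [proj]

lemma proj_of_mem {z : ZMod 2} {v : V} (hv : v ∈ gr (V := V) z) : proj z v = v := by
  rcases parity_cases z with rfl | rfl
  · simpa [proj] using Submodule.projection_apply_of_mem_left (isCompl (V := V)) hv
  · simpa [proj] using Submodule.projection_apply_of_mem_left (isCompl (V := V)).symm hv

lemma proj_of_mem_ne {z w : ZMod 2} {v : V} (hv : v ∈ gr (V := V) z) (hzw : w ≠ z) :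
    proj w v = 0 := by
  rcases parity_cases z with rfl | rfl <;> rcases parity_cases w with rfl | rfl
  · exact absurd rfl hzw
  · simpa [proj] using
      (Submodule.projection_apply_eq_zero_iff (isCompl (V := V)).symm).2 hv
  · simpa [proj] using (Submodule.projection_apply_eq_zero_iff (isCompl (V := V))).2 hv
  · exact absurd rfl hzw

lemma proj_zero_add_proj_one (v : V) : proj 0 v + proj 1 v = v := by
  simpa [proj] using Submodule.projection_add_projection_eq_self (isCompl (V := V)) v

/-- An even linear map commutes with the projections onto the homogeneous components. -/
lemma proj_map {W : Type*} [AddCommGroup W] [Module ℂ W] [SuperSpace W] (f : V →ₗ[ℂ] W)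
    (hf : ∀ z, ∀ v ∈ gr (V := V) z, f v ∈ gr (V := W) z) (z : ZMod 2) (v : V) :
    proj z (f v) = f (proj z v) := by
  have h0 := hf 0 _ (proj_mem 0 v)
  have h1 := hf 1 _ (proj_mem 1 v)
  conv_lhs => rw [← proj_zero_add_proj_one v, map_add, map_add]
  rcases parity_cases z with rfl | rfl
  · rw [proj_of_mem h0, proj_of_mem_ne h1 (by decide), add_zero]
  · rw [proj_of_mem_ne h0 (by decide), proj_of_mem h1, zero_add]

/-- A subspace is graded if it contains the homogeneous components of its elements. -/
def IsGraded (W : Submodule ℂ V) : Prop :=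
  ∀ w ∈ W, ∀ z : ZMod 2, proj z w ∈ W

end

section

variable {V U : Type*} [AddCommGroup V] [Module ℂ V] [SuperSpace V]
  [AddCommGroup U] [Module ℂ U] [SuperSpace U]

/-- The component of parity `c` of a linear map between super spaces. -/
def homProj (c : ZMod 2) : (V →ₗ[ℂ] U) →ₗ[ℂ] (V →ₗ[ℂ] U) where
  toFun m := ∑ w : ZMod 2, proj (w + c) ∘ₗ m ∘ₗ proj w
  map_add' m m' := by
    simp only [LinearMap.add_comp, LinearMap.comp_add, Finset.sum_add_distrib]
  map_smul' r m := by
    simp only [LinearMap.smul_comp, LinearMap.comp_smul, Finset.smul_sum, RingHom.id_apply]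

lemma homProj_apply_of_mem (c : ZMod 2) (m : V →ₗ[ℂ] U) {w : ZMod 2} {v : V}
    (hv : v ∈ gr (V := V) w) : homProj c m v = proj (w + c) (m v) := by
  change (∑ w : ZMod 2, proj (w + c) ∘ₗ m ∘ₗ proj w) v = _
  rw [LinearMap.sum_apply, Finset.sum_eq_single w]
  · simp [proj_of_mem hv]
  · intro b _ hb
    simp [proj_of_mem_ne hv hb]
  · simp

/-- A linear map between super spaces is of parity `c` if it maps `V_w` to `U_{w+c}`. -/
def IsOfParity (c : ZMod 2) (m : V →ₗ[ℂ] U) : Prop :=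
  ∀ w, ∀ v ∈ gr (V := V) w, m v ∈ gr (V := U) (w + c)

lemma hom_ext {M : Type*} [AddCommGroup M] [Module ℂ M] {m m' : V →ₗ[ℂ] M}
    (h : ∀ w, ∀ v ∈ gr (V := V) w, m v = m' v) : m = m' := by
  ext v
  rw [← proj_zero_add_proj_one v, map_add, map_add, h 0 _ (proj_mem 0 v), h 1 _ (proj_mem 1 v)]

lemma isOfParity_homProj (c : ZMod 2) (m : V →ₗ[ℂ] U) : IsOfParity c (homProj c m) := by
  intro w v hv
  rw [homProj_apply_of_mem c m hv]
  exact proj_mem _ _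

lemma homProj_of_isOfParity {c : ZMod 2} {m : V →ₗ[ℂ] U} (hm : IsOfParity c m) :
    homProj c m = m :=
  hom_ext fun w v hv => by rw [homProj_apply_of_mem c m hv, proj_of_mem (hm w v hv)]

lemma homProj_of_isOfParity_ne {b c : ZMod 2} {m : V →ₗ[ℂ] U} (hm : IsOfParity c m)
    (hb : b ≠ c) : homProj b m = 0 :=
  hom_ext fun w v hv => by
    rw [homProj_apply_of_mem b m hv, proj_of_mem_ne (hm w v hv) (fun e => hb (add_left_cancel e)),
      LinearMap.zero_apply]

end

/-- `V ⊗ A` for a super space `V`, with `A` placed in even degree: `(V ⊗ A)_z = V_z ⊗ A`. -/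
instance tensor (V A : Type*) [AddCommGroup V] [Module ℂ V] [SuperSpace V]
    [CommRing A] [Algebra ℂ A] : SuperSpace (V ⊗[ℂ] A) where
  gr z := LinearMap.range ((gr (V := V) z).subtype.rTensor A)
  isCompl := by
    have key : ∀ z w : ZMod 2, ∀ t : gr (V := V) z ⊗[ℂ] A,
        (proj (V := V) w).rTensor A ((gr (V := V) z).subtype.rTensor A t)
          = if w = z then (gr (V := V) z).subtype.rTensor A t else 0 := by
      intro z w t
      induction t with
      | zero => simp
      | add x y hx hy => rw [map_add, map_add, hx, hy]; split_ifs <;> simp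
      | tmul v a =>
        split_ifs with h
        · subst h; simp [proj_of_mem v.2]
        · simp [proj_of_mem_ne v.2 h]
    constructor
    · rw [Submodule.disjoint_def]
      rintro _ ⟨s, rfl⟩ ⟨t, ht⟩
      have h1 := key 0 0 s
      rw [← ht, key 1 0 t] at h1
      simpa [ht] using h1.symm
    · rw [codisjoint_iff, eq_top_iff]
      rintro x -
      induction x with
      | zero => exact Submodule.zero_mem _
      | add x y hx hy => exact Submodule.add_mem _ hx hy
      | tmul v a =>
        rw [← proj_zero_add_proj_one v, TensorProduct.add_tmul]
        exact Submodule.add_mem_sup ⟨⟨_, proj_mem 0 v⟩ ⊗ₜ a, by simp⟩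
          ⟨⟨_, proj_mem 1 v⟩ ⊗ₜ a, by simp⟩

end SuperSpace

open SuperSpace

/-- A structure of complex Lie superalgebra on the super space `L`. -/
class LieSuperalgebra (L : Type*) [AddCommGroup L] [Module ℂ L] [SuperSpace L] where
  bracket : L →ₗ[ℂ] L →ₗ[ℂ] L
  bracket_mem : ∀ i j : ZMod 2, ∀ x ∈ gr (V := L) i, ∀ y ∈ gr (V := L) j,
    bracket x y ∈ gr (V := L) (i + j)
  bracket_skew : ∀ i j : ZMod 2, ∀ x ∈ gr (V := L) i, ∀ y ∈ gr (V := L) j,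
    bracket x y = -(superSign i j • bracket y x)
  jacobi : ∀ i j : ZMod 2, ∀ x ∈ gr (V := L) i, ∀ y ∈ gr (V := L) j, ∀ z : L,
    bracket x (bracket y z) = bracket (bracket x y) z + superSign i j • bracket y (bracket x z)

/-- A structure of module over the Lie superalgebra `L` on the super space `V`. -/
class LieSupermodule (L V : Type*) [AddCommGroup L] [Module ℂ L] [SuperSpace L]
    [LieSuperalgebra L] [AddCommGroup V] [Module ℂ V] [SuperSpace V] where
  act : L →ₗ[ℂ] V →ₗ[ℂ] V
  act_mem : ∀ i j : ZMod 2, ∀ x ∈ gr (V := L) i, ∀ v ∈ gr (V := V) j,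
    act x v ∈ gr (V := V) (i + j)
  act_bracket : ∀ i j : ZMod 2, ∀ x ∈ gr (V := L) i, ∀ y ∈ gr (V := L) j, ∀ v : V,
    act (LieSuperalgebra.bracket x y) v = act x (act y v) - superSign i j • act y (act x v)

/-- A Lie superalgebra is simple if it is not abelian and its only graded ideals are `0` and
itself. -/
structure LieSuperalgebra.IsSimple (L : Type*) [AddCommGroup L] [Module ℂ L] [SuperSpace L]
    [LieSuperalgebra L] : Prop where
  not_abelian : ∃ x y : L, LieSuperalgebra.bracket x y ≠ 0
  eq_bot_or_eq_top : ∀ I : Submodule ℂ L, IsGraded I →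
    (∀ x : L, ∀ y ∈ I, LieSuperalgebra.bracket x y ∈ I) → I = ⊥ ∨ I = ⊤

/-- A module is irreducible if it is nonzero and its only graded submodules are `0` and
itself. -/
structure LieSupermodule.IsIrreducible (L V : Type*) [AddCommGroup L] [Module ℂ L]
    [SuperSpace L] [LieSuperalgebra L] [AddCommGroup V] [Module ℂ V] [SuperSpace V]
    [LieSupermodule L V] : Prop where
  nontrivial : Nontrivial V
  eq_bot_or_eq_top : ∀ W : Submodule ℂ V, IsGraded W →
    (∀ x : L, ∀ w ∈ W, LieSupermodule.act x w ∈ W) → W = ⊥ ∨ W = ⊤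

/-- An action of the group `Γ` on the Lie superalgebra `L` by (even) automorphisms. -/
structure LieSuperalgebra.GroupAction (Γ L : Type*) [Group Γ] [AddCommGroup L] [Module ℂ L]
    [SuperSpace L] [LieSuperalgebra L] where
  toRep : Representation ℂ Γ L
  map_gr : ∀ γ : Γ, ∀ z : ZMod 2, ∀ x ∈ gr (V := L) z, toRep γ x ∈ gr (V := L) z
  map_bracket : ∀ γ : Γ, ∀ x y : L,
    toRep γ (LieSuperalgebra.bracket x y)
      = LieSuperalgebra.bracket (toRep γ x) (toRep γ y)

section MapSuperalgebra

variable (𝔤 A : Type*) [AddCommGroup 𝔤] [Module ℂ 𝔤] [SuperSpace 𝔤] [LieSuperalgebra 𝔤]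
  [CommRing A] [Algebra ℂ A]

/-- The map superalgebra `𝔤 ⊗ A`, with `[x ⊗ a, y ⊗ b] = [x, y] ⊗ ab`. -/
instance mapSuperalgebra : LieSuperalgebra (𝔤 ⊗[ℂ] A) where
  bracket := TensorProduct.map₂ (LieSuperalgebra.bracket (L := 𝔤)) (LinearMap.mul ℂ A)
  bracket_mem := by
    rintro i j _ ⟨s, rfl⟩ _ ⟨t, rfl⟩
    induction s with
    | zero => simp
    | add s s' h h' =>
      rw [map_add, map_add, LinearMap.add_apply]
      exact Submodule.add_mem _ h h'
    | tmul x a =>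
      induction t with
      | zero => simp
      | add t t' h h' =>
        rw [map_add, map_add]
        exact Submodule.add_mem _ h h'
      | tmul y b =>
        exact ⟨⟨_, LieSuperalgebra.bracket_mem (L := 𝔤) i j x x.2 y y.2⟩ ⊗ₜ (a * b), by simp⟩
  bracket_skew := by
    rintro i j _ ⟨s, rfl⟩ _ ⟨t, rfl⟩
    induction s with
    | zero => simp
    | add s s' h h' =>
      rw [map_add, map_add, map_add, LinearMap.add_apply, h, h', smul_add, neg_add]
    | tmul x a =>
      induction t with
      | zero => simp
      | add t t' h h' =>
        rw [map_add, map_add, map_add, LinearMap.add_apply, h, h', smul_add, neg_add]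
      | tmul y b =>
        simp only [LinearMap.rTensor_tmul, Submodule.subtype_apply, TensorProduct.map₂_apply_tmul,
          TensorProduct.map_tmul, LinearMap.mul_apply']
        rw [LieSuperalgebra.bracket_skew (L := 𝔤) i j x x.2 y y.2, TensorProduct.neg_tmul,
          TensorProduct.smul_tmul', mul_comm]
  jacobi := by
    rintro i j _ ⟨s, rfl⟩ _ ⟨t, rfl⟩ u
    induction s with
    | zero => simp
    | add s s' h h' =>
      simp only [map_add, LinearMap.add_apply, h, h', smul_add]
      abel
    | tmul x a =>
      induction t with
      | zero => simp
      | add t t' h h' =>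
        simp only [map_add, LinearMap.add_apply, h, h', smul_add]
        abel
      | tmul y b =>
        induction u with
        | zero => simp
        | add u u' h h' =>
          simp only [map_add, h, h', smul_add]
          abel
        | tmul z c =>
          simp only [LinearMap.rTensor_tmul, Submodule.subtype_apply,
            TensorProduct.map₂_apply_tmul, TensorProduct.map_tmul, LinearMap.mul_apply']
          rw [LieSuperalgebra.jacobi (L := 𝔤) i j x x.2 y y.2, TensorProduct.add_tmul,
            TensorProduct.smul_tmul', mul_assoc, mul_left_comm b a c]

variable {𝔤 A} {Γ : Type*} [Group Γ]

/-- The diagonal action of `Γ` on `𝔤 ⊗ A`: `γ (x ⊗ a) = γ x ⊗ γ a`. -/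
def diagonalAction (σ : LieSuperalgebra.GroupAction Γ 𝔤) (τ : Γ →* (A ≃ₐ[ℂ] A)) (γ : Γ) :
    𝔤 ⊗[ℂ] A →ₗ[ℂ] 𝔤 ⊗[ℂ] A :=
  TensorProduct.map (σ.toRep γ) (τ γ).toLinearMap

/-- The underlying space of `(𝔤 ⊗ A)^Γ`: the fixed points of `Γ` in `𝔤 ⊗ A`. -/
def equivariantMap (σ : LieSuperalgebra.GroupAction Γ 𝔤) (τ : Γ →* (A ≃ₐ[ℂ] A)) :
    Submodule ℂ (𝔤 ⊗[ℂ] A) where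
  carrier := {x | ∀ γ : Γ, diagonalAction σ τ γ x = x}
  add_mem' hx hy γ := by rw [map_add, hx γ, hy γ]
  zero_mem' γ := map_zero _
  smul_mem' r x hx γ := by rw [map_smul, hx γ]

lemma diagonalAction_gr (σ : LieSuperalgebra.GroupAction Γ 𝔤) (τ : Γ →* (A ≃ₐ[ℂ] A)) (γ : Γ)
    (z : ZMod 2) : ∀ x ∈ gr (V := 𝔤 ⊗[ℂ] A) z, diagonalAction σ τ γ x ∈ gr (V := 𝔤 ⊗[ℂ] A) z := by
  rintro _ ⟨t, rfl⟩
  induction t with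
  | zero => simp
  | add s t h h' =>
    rw [map_add, map_add]
    exact Submodule.add_mem _ h h'
  | tmul x a => exact ⟨⟨_, σ.map_gr γ z x x.2⟩ ⊗ₜ τ γ a, by simp [diagonalAction]⟩

lemma diagonalAction_bracket (σ : LieSuperalgebra.GroupAction Γ 𝔤) (τ : Γ →* (A ≃ₐ[ℂ] A))
    (γ : Γ) (x y : 𝔤 ⊗[ℂ] A) :
    diagonalAction σ τ γ (LieSuperalgebra.bracket x y)
      = LieSuperalgebra.bracket (diagonalAction σ τ γ x) (diagonalAction σ τ γ y) := by
  induction x with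
  | zero => simp
  | add x x' h h' => simp only [map_add, LinearMap.add_apply, h, h']
  | tmul x a =>
    induction y with
    | zero => simp
    | add y y' h h' => simp only [map_add, h, h']
    | tmul y b => simp [diagonalAction, LieSuperalgebra.bracket, σ.map_bracket]

/-- The grading of `(𝔤 ⊗ A)^Γ` induced by that of `𝔤 ⊗ A`. -/
instance equivariantMapSuperSpace (σ : LieSuperalgebra.GroupAction Γ 𝔤)
    (τ : Γ →* (A ≃ₐ[ℂ] A)) : SuperSpace (equivariantMap σ τ) where
  gr z := (gr (V := 𝔤 ⊗[ℂ] A) z).comap (equivariantMap σ τ).subtype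
  isCompl := by
    constructor
    · rw [Submodule.disjoint_def]
      intro x h0 h1
      have := Submodule.disjoint_def.1 (isCompl (V := 𝔤 ⊗[ℂ] A)).disjoint x.1 h0 h1
      exact Subtype.ext this
    · rw [codisjoint_iff, eq_top_iff]
      rintro x -
      have hp : ∀ z : ZMod 2, proj z x.1 ∈ equivariantMap σ τ := fun z γ => by
        rw [← proj_map _ (diagonalAction_gr σ τ γ), x.2 γ]
      have hx : x = ⟨proj 0 x.1, hp 0⟩ + ⟨proj 1 x.1, hp 1⟩ :=
        Subtype.ext (proj_zero_add_proj_one x.1).symm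
      rw [hx]
      exact Submodule.add_mem_sup (proj_mem 0 x.1) (proj_mem 1 x.1)

/-- The equivariant map superalgebra `(𝔤 ⊗ A)^Γ`, with the bracket of `𝔤 ⊗ A`. -/
instance equivariantMapSuperalgebra (σ : LieSuperalgebra.GroupAction Γ 𝔤)
    (τ : Γ →* (A ≃ₐ[ℂ] A)) : LieSuperalgebra (equivariantMap σ τ) where
  bracket := LinearMap.mk₂ ℂ
    (fun x y => ⟨LieSuperalgebra.bracket x.1 y.1, fun γ => by
      rw [diagonalAction_bracket, x.2 γ, y.2 γ]⟩)
    (fun x x' y => Subtype.ext (by simp)) (fun r x y => Subtype.ext (by simp))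
    (fun x y y' => Subtype.ext (by simp)) (fun r x y => Subtype.ext (by simp))
  bracket_mem i j x hx y hy := LieSuperalgebra.bracket_mem (L := 𝔤 ⊗[ℂ] A) i j x.1 hx y.1 hy
  bracket_skew i j x hx y hy := Subtype.ext
    (LieSuperalgebra.bracket_skew (L := 𝔤 ⊗[ℂ] A) i j x.1 hx y.1 hy)
  jacobi i j x hx y hy z := Subtype.ext
    (LieSuperalgebra.jacobi (L := 𝔤 ⊗[ℂ] A) i j x.1 hx y.1 hy z.1)

end MapSuperalgebra

section Ext

variable (L V U : Type*) [AddCommGroup L] [Module ℂ L] [SuperSpace L] [LieSuperalgebra L]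
  [AddCommGroup V] [Module ℂ V] [SuperSpace V] [LieSupermodule L V]
  [AddCommGroup U] [Module ℂ U] [SuperSpace U] [LieSupermodule L U]

/-! The start `Hom(V, U) → Hom(L ⊗ V, U) → Hom(Λ²L ⊗ V, U)` of the Chevalley–Eilenberg
cocomplex. A map `f : L ⊗ V → U` is written in the curried form `L → Hom(V, U)`, and a map
`Λ²L ⊗ V → U` as a bilinear map `F : L × L → Hom(V, U)` with `F(x, y) = -(-1)^(|x||y|) F(y, x)`.
The differentials are given on homogeneous elements and extended linearly. -/

/-- `Hom(Λ²L ⊗ V, U)`, where `Λ²` is the exterior square in the super sense. -/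
def cochain₂ : Submodule ℂ (L →ₗ[ℂ] L →ₗ[ℂ] V →ₗ[ℂ] U) where
  carrier := {F | ∀ i j : ZMod 2, ∀ x ∈ gr (V := L) i, ∀ y ∈ gr (V := L) j,
    F x y = -(superSign i j • F y x)}
  add_mem' {F G} hF hG i j x hx y hy := by
    simp only [LinearMap.add_apply]
    rw [hF i j x hx y hy, hG i j x hx y hy, smul_add, neg_add]
  zero_mem' := by simp
  smul_mem' r F hF i j x hx y hy := by
    simp only [LinearMap.smul_apply]
    rw [hF i j x hx y hy, smul_neg, smul_comm]

variable {L V U}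

/-- The value at `x` of the coboundary of `m : V → U`, for `x` of parity `a` and `m` of
parity `c`: it sends `v` to `(-1)^(ac) x (m v) - m (x v)`. -/
def d₀Hom (a c : ZMod 2) (x : L) (m : V →ₗ[ℂ] U) : V →ₗ[ℂ] U :=
  superSign a c • (LieSupermodule.act x ∘ₗ m) - m ∘ₗ LieSupermodule.act x

/-- The value at `(x, y)` of the coboundary of `f`, for `x, y, f` of parities `a, b, c`. For
the action of `L` on `Hom(V, U)` it is
`(-1)^(ac) x f(y) - (-1)^(b(a+c)) y f(x) - f([x, y])`, written out here. -/
def d₁Hom (a b c : ZMod 2) (x y : L) (f : L →ₗ[ℂ] V →ₗ[ℂ] U) : V →ₗ[ℂ] U :=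
  (superSign a c • (LieSupermodule.act x ∘ₗ f y) - superSign a b • (f y ∘ₗ LieSupermodule.act x))
  - (superSign b (a + c) • (LieSupermodule.act y ∘ₗ f x) - f x ∘ₗ LieSupermodule.act y)
  - f (LieSuperalgebra.bracket x y)

/-- The component of parity `c` of a map `f : L ⊗ V → U`. -/
def cochainProj (c : ZMod 2) : (L →ₗ[ℂ] V →ₗ[ℂ] U) →ₗ[ℂ] (L →ₗ[ℂ] V →ₗ[ℂ] U) where
  toFun f := ∑ a : ZMod 2, homProj (a + c) ∘ₗ f ∘ₗ proj a
  map_add' f f' := by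
    simp only [LinearMap.add_comp, LinearMap.comp_add, Finset.sum_add_distrib]
  map_smul' r f := by
    simp only [LinearMap.smul_comp, LinearMap.comp_smul, Finset.smul_sum, RingHom.id_apply]

variable (L V U)

/-- The differential `d⁰ : Hom(V, U) → Hom(L ⊗ V, U)`. -/
def d₀ : (V →ₗ[ℂ] U) →ₗ[ℂ] (L →ₗ[ℂ] V →ₗ[ℂ] U) :=
  LinearMap.mk₂ ℂ
    (fun m x => ∑ a : ZMod 2, ∑ c : ZMod 2, d₀Hom a c (proj a x) (homProj c m))
    (fun m m' x => by
      simp only [d₀Hom, ← Finset.sum_add_distrib, map_add, LinearMap.comp_add,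
        LinearMap.add_comp, smul_add]
      refine Finset.sum_congr rfl fun a _ => Finset.sum_congr rfl fun c _ => ?_
      abel)
    (fun r m x => by
      simp only [d₀Hom, Finset.smul_sum, map_smul, LinearMap.comp_smul, LinearMap.smul_comp,
        smul_sub, smul_comm r])
    (fun m x x' => by
      simp only [d₀Hom, ← Finset.sum_add_distrib, map_add, LinearMap.comp_add,
        LinearMap.add_comp, smul_add]
      refine Finset.sum_congr rfl fun a _ => Finset.sum_congr rfl fun c _ => ?_
      abel)
    (fun r m x => by
      simp only [d₀Hom, Finset.smul_sum, map_smul, LinearMap.comp_smul, LinearMap.smul_comp,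
        smul_sub, smul_comm r])

/-- The differential `d¹` before its values are recognised as lying in `Hom(Λ²L ⊗ V, U)`. -/
def d₁Aux : (L →ₗ[ℂ] V →ₗ[ℂ] U) →ₗ[ℂ] (L →ₗ[ℂ] L →ₗ[ℂ] V →ₗ[ℂ] U) where
  toFun f := LinearMap.mk₂ ℂ
    (fun x y => ∑ a : ZMod 2, ∑ b : ZMod 2, ∑ c : ZMod 2,
      d₁Hom a b c (proj a x) (proj b y) (cochainProj c f))
    (fun x x' y => by
      simp only [d₁Hom, ← Finset.sum_add_distrib, map_add, LinearMap.comp_add,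
        LinearMap.add_comp, smul_add, LinearMap.add_apply]
      refine Finset.sum_congr rfl fun a _ => Finset.sum_congr rfl fun b _ =>
        Finset.sum_congr rfl fun c _ => ?_
      abel)
    (fun r x y => by
      simp only [d₁Hom, Finset.smul_sum, map_smul, LinearMap.comp_smul, LinearMap.smul_comp,
        smul_sub, smul_comm r, LinearMap.smul_apply])
    (fun x y y' => by
      simp only [d₁Hom, ← Finset.sum_add_distrib, map_add, LinearMap.comp_add,
        LinearMap.add_comp, smul_add]
      refine Finset.sum_congr rfl fun a _ => Finset.sum_congr rfl fun b _ =>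
        Finset.sum_congr rfl fun c _ => ?_
      abel)
    (fun r x y => by
      simp only [d₁Hom, Finset.smul_sum, map_smul, LinearMap.comp_smul, LinearMap.smul_comp,
        smul_sub, smul_comm r])
  map_add' f f' := by
    ext x y : 2
    simp only [LinearMap.mk₂_apply, LinearMap.add_apply, d₁Hom, ← Finset.sum_add_distrib, map_add,
      LinearMap.comp_add, LinearMap.add_comp, smul_add]
    refine Finset.sum_congr rfl fun a _ => Finset.sum_congr rfl fun b _ =>
        Finset.sum_congr rfl fun c _ => ?_
    abel
  map_smul' r f := by
    ext x y : 2
    simp only [LinearMap.mk₂_apply, LinearMap.smul_apply, d₁Hom, Finset.smul_sum, map_smul,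
      LinearMap.comp_smul, LinearMap.smul_comp, smul_sub, smul_comm r, RingHom.id_apply]

variable {L V U}

lemma sum_homProj {M : Type*} [AddCommGroup M] {c : ZMod 2} {m : V →ₗ[ℂ] U}
    (hm : IsOfParity c m) (F : ZMod 2 → (V →ₗ[ℂ] U) → M) (hF : ∀ b, F b 0 = 0) :
    ∑ b : ZMod 2, F b (homProj b m) = F c m := by
  rw [Finset.sum_eq_single c]
  · rw [homProj_of_isOfParity hm]
  · intro b _ hb
    rw [homProj_of_isOfParity_ne hm hb, hF]
  · simp

lemma sum_proj {M : Type*} [AddCommGroup M] {a : ZMod 2} {x : L}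
    (hx : x ∈ gr (V := L) a) (F : ZMod 2 → L → M) (hF : ∀ b, F b 0 = 0) :
    ∑ b : ZMod 2, F b (proj b x) = F a x := by
  rw [Finset.sum_eq_single a]
  · rw [proj_of_mem hx]
  · intro b _ hb
    rw [proj_of_mem_ne hx hb, hF]
  · simp

lemma sum_cochainProj {M : Type*} [AddCommGroup M] {c : ZMod 2} {f : L →ₗ[ℂ] V →ₗ[ℂ] U}
    (hf : ∀ a, ∀ x ∈ gr (V := L) a, IsOfParity (a + c) (f x))
    (F : ZMod 2 → (L →ₗ[ℂ] V →ₗ[ℂ] U) → M) (hF : ∀ b, F b 0 = 0) :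
    ∑ b : ZMod 2, F b (cochainProj b f) = F c f := by
  have key : ∀ b, cochainProj b f = if b = c then f else 0 := by
    intro b
    refine hom_ext fun a x hx => ?_
    have : cochainProj b f x = homProj (a + b) (f x) := by
      change (∑ a : ZMod 2, homProj (a + b) ∘ₗ f ∘ₗ proj a) x = _
      rw [LinearMap.sum_apply]
      exact sum_proj hx (fun a x => homProj (a + b) (f x)) (by simp)
    rw [this]
    split_ifs with h
    · rw [h, homProj_of_isOfParity (hf a x hx)]
    · rw [homProj_of_isOfParity_ne (hf a x hx) (fun e => h (add_left_cancel e)),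
        LinearMap.zero_apply]
  rw [Finset.sum_eq_single c]
  · rw [key, if_pos rfl]
  · intro b _ hb
    rw [key, if_neg hb, hF]
  · simp

/-- The formula for `d⁰` on homogeneous elements. -/
lemma d₀_apply_of_mem {a c : ZMod 2} {x : L} (hx : x ∈ gr (V := L) a) {m : V →ₗ[ℂ] U}
    (hm : IsOfParity c m) : d₀ L V U m x = d₀Hom a c x m := by
  rw [d₀, LinearMap.mk₂_apply]
  refine (Finset.sum_congr rfl fun a _ =>
    sum_homProj hm (fun c m => d₀Hom a c (proj a x) m) (by simp [d₀Hom])).trans ?_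
  exact sum_proj hx (fun a x => d₀Hom a c x m) (by simp [d₀Hom])

/-- The formula for `d¹` on homogeneous elements. -/
lemma d₁Aux_apply_of_mem {a b c : ZMod 2} {x y : L} (hx : x ∈ gr (V := L) a)
    (hy : y ∈ gr (V := L) b) {f : L →ₗ[ℂ] V →ₗ[ℂ] U}
    (hf : ∀ a, ∀ x ∈ gr (V := L) a, IsOfParity (a + c) (f x)) :
    d₁Aux L V U f x y = d₁Hom a b c x y f := by
  change ∑ a : ZMod 2, ∑ b : ZMod 2, ∑ c : ZMod 2,
      d₁Hom a b c (proj a x) (proj b y) (cochainProj c f) = _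
  refine (Finset.sum_congr rfl fun a _ => (Finset.sum_congr rfl fun b _ =>
    sum_cochainProj hf (fun c f => d₁Hom a b c (proj a x) (proj b y) f)
      (by simp [d₁Hom])).trans
    (sum_proj hy (fun b y => d₁Hom a b c (proj a x) y f) (by simp [d₁Hom]))).trans ?_
  exact sum_proj hx (fun a x => d₁Hom a b c x y f) (by simp [d₁Hom])

lemma d₁Hom_skew {a b : ZMod 2} {x y : L} (hx : x ∈ gr (V := L) a)
    (hy : y ∈ gr (V := L) b) (c : ZMod 2) (f : L →ₗ[ℂ] V →ₗ[ℂ] U) :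
    d₁Hom a b c x y f = -(superSign a b • d₁Hom b a c y x f) := by
  unfold d₁Hom
  rw [LieSuperalgebra.bracket_skew a b x hx y hy]
  rcases parity_cases a with rfl | rfl <;> rcases parity_cases b with rfl | rfl <;>
    rcases parity_cases c with rfl | rfl <;>
    simp only [sign_zero_left, sign_zero_right, sign_one_one, parity_one_add_one, zero_add,
      add_zero, one_smul, neg_smul, map_neg] <;> abel

lemma d₁Aux_mem (f : L →ₗ[ℂ] V →ₗ[ℂ] U) : d₁Aux L V U f ∈ cochain₂ L V U := by
  have h : ∀ i j : ZMod 2, ∀ x ∈ gr (V := L) i, ∀ y ∈ gr (V := L) j,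
      d₁Aux L V U f x y = ∑ c : ZMod 2, d₁Hom i j c x y (cochainProj c f) := by
    intro i j x hx y hy
    change ∑ a : ZMod 2, ∑ b : ZMod 2, ∑ c : ZMod 2,
      d₁Hom a b c (proj a x) (proj b y) (cochainProj c f) = _
    refine (Finset.sum_congr rfl fun a _ =>
      sum_proj hy (fun b y => ∑ c : ZMod 2, d₁Hom a b c (proj a x) y (cochainProj c f))
        (by simp [d₁Hom])).trans ?_
    exact sum_proj hx (fun a x => ∑ c : ZMod 2, d₁Hom a j c x y (cochainProj c f))
      (by simp [d₁Hom])
  intro i j x hx y hy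
  rw [h i j x hx y hy, h j i y hy x hx, Finset.smul_sum, ← Finset.sum_neg_distrib]
  exact Finset.sum_congr rfl fun c _ => d₁Hom_skew hx hy c _

variable (L V U)

/-- The differential `d¹ : Hom(L ⊗ V, U) → Hom(Λ²L ⊗ V, U)`. -/
def d₁ : (L →ₗ[ℂ] V →ₗ[ℂ] U) →ₗ[ℂ] cochain₂ L V U :=
  (d₁Aux L V U).codRestrict (cochain₂ L V U) d₁Aux_mem

lemma d₁_d₀ (m : V →ₗ[ℂ] U) : d₁ L V U (d₀ L V U m) = 0 := by
  have key : ∀ c : ZMod 2, ∀ m : V →ₗ[ℂ] U, IsOfParity c m →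
      d₁Aux L V U (d₀ L V U m) = 0 := by
    intro c m hm
    have hf : ∀ a, ∀ x ∈ gr (V := L) a, IsOfParity (a + c) (d₀ L V U m x) := by
      intro a x hx w v hv
      rw [d₀_apply_of_mem hx hm]
      refine Submodule.sub_mem _ (Submodule.smul_mem _ _ ?_) ?_
      · have := LieSupermodule.act_mem a (w + c) x hx _ (hm w v hv)
        rwa [add_left_comm] at this
      · have := hm _ _ (LieSupermodule.act_mem a w x hx v hv)
        rwa [add_comm a w, add_assoc] at this
    refine hom_ext fun a x hx => hom_ext fun b y hy => ?_
    rw [d₁Aux_apply_of_mem hx hy hf, d₁Hom, d₀_apply_of_mem hx hm, d₀_apply_of_mem hy hm,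
      d₀_apply_of_mem (LieSuperalgebra.bracket_mem a b x hx y hy) hm]
    ext v
    simp only [d₀Hom, LinearMap.sub_apply, LinearMap.smul_apply, LinearMap.comp_apply,
      LinearMap.zero_apply, LieSupermodule.act_bracket a b x hx y hy, map_sub, map_smul]
    rcases parity_cases a with rfl | rfl <;> rcases parity_cases b with rfl | rfl <;>
      rcases parity_cases c with rfl | rfl <;>
      simp only [sign_zero_left, sign_zero_right, sign_one_one, parity_one_add_one, zero_add,
        add_zero, one_smul, neg_smul, smul_neg, smul_sub] <;> abel
  have hm : m = homProj 0 m + homProj 1 m := by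
    refine hom_ext fun w v hv => ?_
    rw [LinearMap.add_apply, homProj_apply_of_mem 0 m hv, homProj_apply_of_mem 1 m hv]
    rcases parity_cases w with rfl | rfl
    · simp only [zero_add]
      exact (proj_zero_add_proj_one _).symm
    · simp only [add_zero, parity_one_add_one]
      rw [add_comm]
      exact (proj_zero_add_proj_one _).symm
  apply Subtype.ext
  change d₁Aux L V U (d₀ L V U m) = 0
  rw [hm, map_add, map_add, key 0 _ (isOfParity_homProj 0 m), key 1 _ (isOfParity_homProj 1 m),
    add_zero]

/-- `Ext¹_L(V, U) = ker d¹ / im d⁰`. -/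
abbrev SuperExt₁ : Type _ :=
  LinearMap.ker (d₁ L V U) ⧸
    LinearMap.range ((d₀ L V U).codRestrict (LinearMap.ker (d₁ L V U)) (d₁_d₀ L V U))

end Ext

end

/-! Write `L` for `(𝔤 ⊗ A)^Γ` and `K` for the common annihilator of the two modules, a graded ideal
of finite codimension. On `K × K` the cocycle condition reduces to `f([x, y]) = 0`, so every
1-cocycle factors through `L / [K, K]`. As the modules are finite-dimensional, it suffices that `[K,
K]` has finite codimension (`SuperExt₁.finiteDimensional_of_finite_quotient`).

Two facts give this. The first is that `L` is perfect (`equivariantMap_perfect`). Freeness on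
maximal ideals provides `∑ aᵢ ⊗ bᵢ` in `A ⊗ A` with `∑ aᵢ δ(bᵢ)` equal to 1 for `δ = 1` and to 0
otherwise. Brackets of orbit sums weighted by this element isolate the orbit sum of `[x, y] ⊗ c`,
and `𝔤` is perfect.

The second is `equivariantMap_finite_quotient_map₂_bracket`. Perfectness shows that `K' = [K, L]`
still has finite codimension, and `K'` is stable under `B = A^Γ`. Let `J` be the set of `b` in `B`
with `bL ⊆ K'`, and `I = AJ`. Each `b` in `B` is a root modulo `J` of a monic polynomial, since `L /
K'` is finite-dimensional. As `A` is integral over `B` and finitely generated, `A / I²` is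
finite-dimensional. Finally `bb'[x, y] = [bx, b'y]` with `b, b'` in `J` puts the orbit sums of `𝔤 ⊗
I²` inside `[K, K]`. -/

noncomputable section

open SuperSpace

/-! ### Decomposition into homogeneous components -/

section SuperSpace

variable {V U : Type*} [AddCommGroup V] [Module ℂ V] [SuperSpace V]
  [AddCommGroup U] [Module ℂ U] [SuperSpace U]

lemma SuperSpace.sum_proj_eq (v : V) : ∑ a : ZMod 2, proj a v = v :=
  (Fin.sum_univ_two _).trans (proj_zero_add_proj_one v)

lemma sum_homProj_eq (m : V →ₗ[ℂ] U) : ∑ c : ZMod 2, homProj c m = m := by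
  refine hom_ext fun w v hv => ?_
  rw [LinearMap.sum_apply]
  simp only [homProj_apply_of_mem _ m hv]
  conv_rhs => rw [← sum_proj_eq (m v)]
  exact Fintype.sum_equiv (Equiv.addLeft w) _ _ (fun c => rfl)

end SuperSpace

/-! ### Cocycles and annihilators -/

section Ext

variable {L V U : Type*} [AddCommGroup L] [Module ℂ L] [SuperSpace L] [LieSuperalgebra L]
  [AddCommGroup V] [Module ℂ V] [SuperSpace V] [LieSupermodule L V]
  [AddCommGroup U] [Module ℂ U] [SuperSpace U] [LieSupermodule L U]

lemma cochainProj_apply_proj (a c : ZMod 2) (f : L →ₗ[ℂ] V →ₗ[ℂ] U) (x : L) :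
    cochainProj c f (proj a x) = homProj (a + c) (f (proj a x)) := by
  change (∑ a : ZMod 2, homProj (a + c) ∘ₗ f ∘ₗ proj a) (proj a x) = _
  rw [LinearMap.sum_apply]
  exact sum_proj (proj_mem a x) (fun a x => homProj (a + c) (f x)) (by simp)

lemma sum_cochainProj_eq (f : L →ₗ[ℂ] V →ₗ[ℂ] U) : ∑ c : ZMod 2, cochainProj c f = f := by
  refine hom_ext fun a x hx => ?_
  rw [LinearMap.sum_apply]
  have h : ∀ c : ZMod 2, cochainProj c f x = homProj (a + c) (f x) := fun c => by
    simpa [proj_of_mem hx] using cochainProj_apply_proj a c f x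
  simp only [h]
  conv_rhs => rw [← sum_homProj_eq (f x)]
  exact Fintype.sum_equiv (Equiv.addLeft a) _ _ (fun c => rfl)

variable (L V) in
/-- The annihilator of a module over a Lie superalgebra. -/
def LieSupermodule.annihilator : Submodule ℂ L :=
  LinearMap.ker (LieSupermodule.act (L := L) (V := V))

/-- On a homogeneous `v` the components of `x` send `v` into different degrees, so they cannot
cancel each other. -/
lemma LieSupermodule.act_proj_eq_zero {x : L} (hx : x ∈ LieSupermodule.annihilator L V)
    (a : ZMod 2) : LieSupermodule.act (V := V) (proj a x) = 0 := by
  have hx' : LieSupermodule.act (V := V) x = 0 := hx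
  have h : ∀ w, ∀ v ∈ gr (V := V) w, LieSupermodule.act (proj a x) v = 0 := by
    intro w v hv
    have h1 : ∑ b : ZMod 2, LieSupermodule.act (proj b x) v = 0 := by
      rw [← LinearMap.sum_apply, ← map_sum, sum_proj_eq, hx', LinearMap.zero_apply]
    have h2 := congrArg (proj (a + w)) h1
    rw [map_sum, Finset.sum_eq_single a, map_zero] at h2
    · rwa [proj_of_mem (LieSupermodule.act_mem a w _ (proj_mem a x) v hv)] at h2
    · intro b _ hb
      exact proj_of_mem_ne (LieSupermodule.act_mem b w _ (proj_mem b x) v hv)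
        (fun e => hb (add_right_cancel e).symm)
    · simp
  exact hom_ext fun w v hv => by rw [h w v hv, LinearMap.zero_apply]

lemma LieSupermodule.isGraded_annihilator : IsGraded (LieSupermodule.annihilator L V) :=
  fun _ hx a => LieSupermodule.act_proj_eq_zero hx a

lemma LieSupermodule.bracket_mem_annihilator {x : L} (hx : x ∈ LieSupermodule.annihilator L V)
    (y : L) : LieSuperalgebra.bracket x y ∈ LieSupermodule.annihilator L V := by
  rw [← sum_proj_eq x, ← sum_proj_eq y]
  simp only [map_sum, LinearMap.sum_apply]
  refine Submodule.sum_mem _ fun a _ => Submodule.sum_mem _ fun b _ => ?_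
  refine LinearMap.mem_ker.2 (LinearMap.ext fun v => ?_)
  rw [LieSupermodule.act_bracket b a _ (proj_mem _ _) _ (proj_mem _ _)]
  simp [LieSupermodule.act_proj_eq_zero hx]

-- The quotient embeds in `End V × End U`, because the intersection is the kernel of the product of
-- the two actions.
variable (L V U) in
lemma LieSupermodule.finite_quotient_inf_annihilator [FiniteDimensional ℂ V]
    [FiniteDimensional ℂ U] : FiniteDimensional ℂ
      (L ⧸ LieSupermodule.annihilator L V ⊓ LieSupermodule.annihilator L U) := by
  unfold LieSupermodule.annihilator
  rw [← LinearMap.ker_prod]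
  exact Module.Finite.equiv (LinearMap.quotKerEquivRange _).symm

/-- All terms of `d¹` except the last contain an action of a component of `x` or `y`. The signs
depend on parities, so it matters that each homogeneous component acts by zero, not only `x` and `y`
themselves. -/
lemma d₁Aux_apply_of_act_eq_zero (f : L →ₗ[ℂ] V →ₗ[ℂ] U) {x y : L}
    (hx : x ∈ LieSupermodule.annihilator L V ⊓ LieSupermodule.annihilator L U)
    (hy : y ∈ LieSupermodule.annihilator L V ⊓ LieSupermodule.annihilator L U) :
    d₁Aux L V U f x y = -f (LieSuperalgebra.bracket x y) := by
  have hc : ∀ z, ∑ c : ZMod 2, cochainProj c f z = f z := fun z => by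
    rw [← LinearMap.sum_apply, sum_cochainProj_eq]
  change ∑ a : ZMod 2, ∑ b : ZMod 2, ∑ c : ZMod 2,
    d₁Hom a b c (proj a x) (proj b y) (cochainProj c f) = _
  simp only [d₁Hom, LieSupermodule.act_proj_eq_zero hx.1, LieSupermodule.act_proj_eq_zero hx.2,
    LieSupermodule.act_proj_eq_zero hy.1, LieSupermodule.act_proj_eq_zero hy.2,
    LinearMap.zero_comp, LinearMap.comp_zero, smul_zero, sub_zero, zero_sub,
    Finset.sum_neg_distrib, hc]
  conv_rhs => rw [← sum_proj_eq x, ← sum_proj_eq y]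
  simp only [map_sum, LinearMap.sum_apply]
  rw [Finset.sum_comm]

variable (L V U) in
/-- The first extension space is finite-dimensional as soon as the derived algebra of the common
annihilator has finite codimension: cocycles vanish on it. -/
lemma SuperExt₁.finiteDimensional_of_finite_quotient [FiniteDimensional ℂ V]
    [FiniteDimensional ℂ U]
    (h : FiniteDimensional ℂ (L ⧸ Submodule.map₂ (LieSuperalgebra.bracket (L := L))
      (LieSupermodule.annihilator L V ⊓ LieSupermodule.annihilator L U)
      (LieSupermodule.annihilator L V ⊓ LieSupermodule.annihilator L U))) :
    FiniteDimensional ℂ (SuperExt₁ L V U) := by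
  set N := Submodule.map₂ (LieSuperalgebra.bracket (L := L))
    (LieSupermodule.annihilator L V ⊓ LieSupermodule.annihilator L U)
    (LieSupermodule.annihilator L V ⊓ LieSupermodule.annihilator L U)
  -- Cocycles are pulled back from the finite-dimensional space of maps `L / N → Hom(V, U)`.
  have hle : LinearMap.ker (d₁ L V U) ≤
      LinearMap.range (LinearMap.lcomp ℂ (V →ₗ[ℂ] U) N.mkQ) := by
    intro f hf
    have hN : N ≤ LinearMap.ker f := Submodule.map₂_le.2 fun x hx y hy => by
      have h : d₁Aux L V U f x y = 0 := by
        have : d₁Aux L V U f = 0 := congrArg Subtype.val (LinearMap.mem_ker.1 hf)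
        simp [this]
      rw [d₁Aux_apply_of_act_eq_zero f hx hy] at h
      exact neg_eq_zero.1 h
    exact ⟨N.liftQ f hN, N.liftQ_mkQ f hN⟩
  have : FiniteDimensional ℂ (LinearMap.ker (d₁ L V U)) :=
    Submodule.finiteDimensional_of_le hle
  infer_instance

end Ext

/-! ### Perfect Lie superalgebras and finite codimension -/

section Perfect

variable {L : Type*} [AddCommGroup L] [Module ℂ L]

lemma Module.Finite.quotient_of_sup_eq_top {N G : Submodule ℂ L} (hG : G.FG) (h : G ⊔ N = ⊤) :
    Module.Finite ℂ (L ⧸ N) := by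
  refine ⟨?_⟩
  have := hG.map N.mkQ
  rwa [← sup_bot_eq (G.map N.mkQ), ← Submodule.mkQ_map_self N, ← Submodule.map_sup, h,
    Submodule.map_top, Submodule.range_mkQ] at this

lemma Submodule.exists_fg_sup_eq_top (N : Submodule ℂ L) [Module.Finite ℂ (L ⧸ N)] :
    ∃ G : Submodule ℂ L, G.FG ∧ G ⊔ N = ⊤ := by
  obtain ⟨G, hG⟩ := N.exists_isCompl
  have : Module.Finite ℂ G := Module.Finite.equiv (Submodule.quotientEquivOfIsCompl N G hG)
  exact ⟨G, Module.Finite.iff_fg.1 this, hG.symm.sup_eq_top⟩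

variable [SuperSpace L] [LieSuperalgebra L]

/-- Skew-symmetry is available only for homogeneous elements; gradedness of `K` keeps the components
of `y` in `K`. -/
lemma LieSuperalgebra.bracket_mem_map₂_of_right {K : Submodule ℂ L} (hK : IsGraded K) (x : L)
    {y : L} (hy : y ∈ K) :
    LieSuperalgebra.bracket x y ∈ Submodule.map₂ (LieSuperalgebra.bracket (L := L)) K ⊤ := by
  rw [← sum_proj_eq x, ← sum_proj_eq y]
  simp only [map_sum, LinearMap.sum_apply]
  refine Submodule.sum_mem _ fun a _ => Submodule.sum_mem _ fun b _ => ?_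
  rw [LieSuperalgebra.bracket_skew b a _ (proj_mem _ _) _ (proj_mem _ _)]
  exact Submodule.neg_mem _ (Submodule.smul_mem _ _
    (Submodule.apply_mem_map₂ _ (hK _ hy _) trivial))

/-- In a perfect Lie superalgebra, `[K, L]` has finite codimension if `K` has. -/
lemma LieSuperalgebra.finite_quotient_map₂_bracket
    (hL : Submodule.map₂ (LieSuperalgebra.bracket (L := L)) ⊤ ⊤ = ⊤) {K : Submodule ℂ L}
    (hK : IsGraded K) [Module.Finite ℂ (L ⧸ K)] :
    Module.Finite ℂ (L ⧸ Submodule.map₂ (LieSuperalgebra.bracket (L := L)) K ⊤) := by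
  obtain ⟨G, hG, hGK⟩ := K.exists_fg_sup_eq_top
  refine Module.Finite.quotient_of_sup_eq_top
    (Submodule.FG.map₂ (LieSuperalgebra.bracket (L := L)) hG hG) ?_
  -- With `L = G + K`, expanding `[g + k, g' + k']` leaves `[g, g']` in the finite-dimensional `[G,
  -- G]`; the other terms lie in `[K, L]`.
  refine top_unique (hL.ge.trans (Submodule.map₂_le.2 ?_))
  intro x _ y _
  obtain ⟨g, hg, k, hk, rfl⟩ := Submodule.mem_sup.1 (hGK.ge (Submodule.mem_top (x := x)))
  obtain ⟨g', hg', k', hk', rfl⟩ := Submodule.mem_sup.1 (hGK.ge (Submodule.mem_top (x := y)))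
  rw [LinearMap.map_add₂, map_add, add_assoc]
  refine Submodule.add_mem_sup (Submodule.apply_mem_map₂ _ hg hg') (Submodule.add_mem _
    (LieSuperalgebra.bracket_mem_map₂_of_right hK _ hk') ?_)
  exact Submodule.apply_mem_map₂ _ hk trivial

/-- The derived algebra is a graded ideal, since brackets of homogeneous elements are homogeneous,
and it is nonzero because the algebra is not abelian. -/
lemma LieSuperalgebra.IsSimple.perfect (h : LieSuperalgebra.IsSimple L) :
    Submodule.map₂ (LieSuperalgebra.bracket (L := L)) ⊤ ⊤ = ⊤ := by
  refine (h.eq_bot_or_eq_top _ ?_ fun x y _ =>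
    Submodule.apply_mem_map₂ _ Submodule.mem_top Submodule.mem_top).resolve_left fun h0 => ?_
  · intro w hw z
    suffices Submodule.map₂ (LieSuperalgebra.bracket (L := L)) ⊤ ⊤ ≤
        (Submodule.map₂ (LieSuperalgebra.bracket (L := L)) ⊤ ⊤).comap (proj z) from this hw
    refine Submodule.map₂_le.2 fun x _ y _ => ?_
    rw [Submodule.mem_comap, ← sum_proj_eq x, ← sum_proj_eq y]
    simp only [map_sum, LinearMap.sum_apply]
    refine Submodule.sum_mem _ fun a _ => Submodule.sum_mem _ fun b _ => ?_
    have hm := LieSuperalgebra.bracket_mem b a _ (proj_mem b x) _ (proj_mem a y)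
    by_cases hz : z = b + a
    · rw [hz, proj_of_mem hm]
      exact Submodule.apply_mem_map₂ _ trivial trivial
    · rw [proj_of_mem_ne hm hz]
      exact Submodule.zero_mem _
  · obtain ⟨x, y, hxy⟩ := h.not_abelian
    refine hxy ((Submodule.mem_bot ℂ).1 (h0 ▸ ?_))
    exact Submodule.apply_mem_map₂ _ trivial trivial

end Perfect

/-! ### Invariants of a finite group and free actions -/

section GroupAction

variable {A Γ : Type*} [CommRing A] [Algebra ℂ A] [Group Γ] (τ : Γ →* (A ≃ₐ[ℂ] A))

/-- The subalgebra of fixed points of a group of algebra automorphisms. -/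
def invariants : Subalgebra ℂ A where
  carrier := {a | ∀ γ, τ γ a = a}
  mul_mem' ha hb γ := by rw [map_mul, ha γ, hb γ]
  add_mem' ha hb γ := by rw [map_add, ha γ, hb γ]
  algebraMap_mem' r γ := AlgEquiv.commutes _ r

lemma isIntegral_invariants [Finite Γ] : Algebra.IsIntegral (invariants τ) A := by
  let _ : MulSemiringAction Γ A := MulSemiringAction.compHom A τ
  have : Algebra.IsInvariant (invariants τ) A Γ := ⟨fun a ha => ⟨⟨a, ha⟩, rfl⟩⟩
  exact Algebra.IsInvariant.isIntegral (invariants τ) A Γ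

/-- A quotient of a finitely generated algebra is finite-dimensional if the images of the
invariants of a finite group are integral. -/
lemma finite_quotient_of_isIntegral_invariants [Finite Γ] [Algebra.FiniteType ℂ A] (I : Ideal A)
    (hI : ∀ b ∈ invariants τ, IsIntegral ℂ (Ideal.Quotient.mk I b)) :
    Module.Finite ℂ (A ⧸ I) := by
  -- The invariants land in the integral closure of `ℂ` in `A / I`, so integrality of `A` over them
  -- passes to integrality of `A / I` over `ℂ` by transitivity.
  let φ : invariants τ →+* integralClosure ℂ (A ⧸ I) :=
    ((Ideal.Quotient.mk I).comp (invariants τ).val.toRingHom).codRestrict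
      (integralClosure ℂ (A ⧸ I)) fun b => hI b b.2
  have := isIntegral_invariants τ
  have : Algebra.IsIntegral ℂ (A ⧸ I) := by
    refine ⟨fun x => ?_⟩
    obtain ⟨a, rfl⟩ := Ideal.Quotient.mk_surjective x
    exact isIntegral_trans (A := integralClosure ℂ (A ⧸ I)) _
      (IsIntegral.map_of_comp_eq φ (Ideal.Quotient.mk I) rfl
        (Algebra.IsIntegral.isIntegral (R := invariants τ) a))
  exact Algebra.IsIntegral.finite

/-- The monic polynomial `p * p` takes `a` into `I * I`. -/
lemma isIntegral_quotient_mul_self {a : A} {I : Ideal A} {p : Polynomial ℂ} (hp : p.Monic)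
    (h : Polynomial.aeval a p ∈ I) : IsIntegral ℂ (Ideal.Quotient.mk (I * I) a) := by
  refine ⟨p * p, hp.mul hp, ?_⟩
  have : Polynomial.aeval (Ideal.Quotient.mkₐ ℂ (I * I) a) (p * p) = 0 := by
    rw [Polynomial.aeval_algHom_apply, map_mul]
    exact Ideal.Quotient.eq_zero_iff_mem.2 (Ideal.mul_mem_mul h h)
  exact this

/-- For a free action on the maximal spectrum, `A ⊗ A` contains an element which separates the
identity from the other automorphisms. -/
lemma exists_productMap_eq_ite [Fintype Γ] [DecidableEq Γ]
    (hfree : ∀ 𝔪 : MaximalSpectrum A, ∀ γ : Γ,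
      Ideal.map (τ γ) 𝔪.asIdeal = 𝔪.asIdeal → γ = 1) :
    ∃ e : A ⊗[ℂ] A, ∀ δ : Γ,
      Algebra.TensorProduct.productMap (AlgHom.id ℂ A) (τ δ).toAlgHom e
        = if δ = 1 then 1 else 0 := by
  let μ : Γ → (A ⊗[ℂ] A →ₐ[ℂ] A) := fun δ =>
    Algebra.TensorProduct.productMap (AlgHom.id ℂ A) (τ δ).toAlgHom
  have key : ∀ γ : Γ, γ ≠ 1 → ∃ e : A ⊗[ℂ] A, μ 1 e = 1 ∧ μ γ e = 0 := by
    intro γ hγ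
    -- Otherwise some maximal ideal contains every `a - γ a`; then `γ` is the identity modulo it,
    -- hence fixes it, against freeness.
    have hspan : Ideal.span (Set.range fun a => a - τ γ a) = ⊤ := by
      by_contra hne
      obtain ⟨𝔪, h𝔪, hle⟩ := Ideal.exists_le_maximal _ hne
      have hsub : ∀ a, a - τ γ a ∈ 𝔪 := fun a => hle (Ideal.subset_span ⟨a, rfl⟩)
      refine hγ (hfree ⟨𝔪, h𝔪⟩ γ (le_antisymm (Ideal.map_le_iff_le_comap.2 fun a ha => ?_) ?_))
      · have := 𝔪.sub_mem ha (hsub a)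
        rwa [sub_sub_cancel] at this
      · intro a ha
        have h1 := hsub ((τ γ).symm a)
        rw [AlgEquiv.apply_symm_apply] at h1
        have h2 := 𝔪.add_mem h1 ha
        rw [sub_add_cancel] at h2
        have h3 := Ideal.mem_map_of_mem (τ γ) h2
        rwa [AlgEquiv.apply_symm_apply] at h3
    -- The values of `μ 1` on the kernel of `μ γ` form an ideal of `A`, so only the generators need
    -- explicit preimages.
    have hmem : ∀ c ∈ Ideal.span (Set.range fun a => a - τ γ a),
        ∃ e : A ⊗[ℂ] A, μ 1 e = c ∧ μ γ e = 0 := by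
      intro c hc
      induction hc using Submodule.span_induction with
      | mem x hx =>
        obtain ⟨a, rfl⟩ := hx
        -- `μ 1` sends this to `a - γ a`, and `μ γ` sends it to `γ a - γ a`.
        exact ⟨1 ⊗ₜ a - τ γ a ⊗ₜ 1, by simp [μ], by simp [μ]⟩
      | zero => exact ⟨0, by simp, by simp⟩
      | add x y _ _ hx hy =>
        obtain ⟨e, h1, h2⟩ := hx
        obtain ⟨e', h1', h2'⟩ := hy
        exact ⟨e + e', by rw [map_add, h1, h1'], by rw [map_add, h2, h2', add_zero]⟩
      | smul r x _ hx =>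
        obtain ⟨e, h1, h2⟩ := hx
        exact ⟨r ⊗ₜ 1 * e, by rw [map_mul, h1]; simp [μ], by rw [map_mul, h2, mul_zero]⟩
    exact hmem 1 (hspan ▸ Submodule.mem_top)
  choose! e he1 he2 using key
  -- Each `μ δ` is multiplicative: `μ 1` is 1 on every factor, while for `δ ≠ 1` the factor `e δ` is
  -- killed.
  refine ⟨∏ γ ∈ Finset.univ.erase 1, e γ, fun δ => ?_⟩
  change μ δ _ = _
  rw [map_prod]
  split_ifs with h
  · subst h
    exact Finset.prod_eq_one fun γ hγ => he1 γ (Finset.ne_of_mem_erase hγ)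
  · exact Finset.prod_eq_zero (Finset.mem_erase.2 ⟨h, Finset.mem_univ δ⟩) (he2 δ h)

end GroupAction

/-! ### Perfectness and ideals of the equivariant map superalgebra -/

section EquivariantMap

variable {𝔤 A Γ : Type*} [AddCommGroup 𝔤] [Module ℂ 𝔤] [SuperSpace 𝔤] [LieSuperalgebra 𝔤]
  [CommRing A] [Algebra ℂ A] [Group Γ]
  (σ : LieSuperalgebra.GroupAction Γ 𝔤) (τ : Γ →* (A ≃ₐ[ℂ] A))

/-- The sum over the orbits of `Γ`, as a map from `𝔤 ⊗ A` to `(𝔤 ⊗ A)^Γ`. -/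
def orbitSum [Fintype Γ] : 𝔤 ⊗[ℂ] A →ₗ[ℂ] equivariantMap σ τ :=
  (∑ γ : Γ, diagonalAction σ τ γ).codRestrict (equivariantMap σ τ) fun x γ => by
    have hmul : ∀ δ, diagonalAction σ τ γ (diagonalAction σ τ δ x)
        = diagonalAction σ τ (γ * δ) x := fun δ => by
      rw [← LinearMap.comp_apply]
      congr 1
      ext y a
      simp [diagonalAction]
    rw [LinearMap.sum_apply, map_sum]
    simp only [hmul]
    exact Fintype.sum_equiv (Equiv.mulLeft γ) _ _ fun δ => rfl

lemma coe_orbitSum [Fintype Γ] (x : 𝔤 ⊗[ℂ] A) :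
    (orbitSum σ τ x : 𝔤 ⊗[ℂ] A) = ∑ γ : Γ, diagonalAction σ τ γ x :=
  LinearMap.sum_apply _ _ _

/-- A fixed point is the orbit sum of itself divided by `|Γ|`. -/
lemma orbitSum_surjective [Fintype Γ] : Function.Surjective (orbitSum σ τ) := fun x =>
  ⟨(Fintype.card Γ : ℂ)⁻¹ • x, Subtype.ext <| by
    rw [coe_orbitSum, ← LinearMap.sum_apply]
    have h : (∑ γ : Γ, diagonalAction σ τ γ) (x : 𝔤 ⊗[ℂ] A) = (Fintype.card Γ : ℂ) • x := by
      rw [LinearMap.sum_apply, Finset.sum_congr rfl fun γ _ => x.2 γ, Finset.sum_const,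
        Finset.card_univ, Nat.cast_smul_eq_nsmul]
    rw [map_smul, h, smul_smul, inv_mul_cancel₀ (by simp), one_smul]⟩

/-- The double sum over pairs in `Γ` is reindexed by `(γ, γδ)`, and `γ` is factored out of the
bracket. The coefficients `a * τ δ b` are the values on `a ⊗ b` of the maps that
`exists_productMap_eq_ite` separates. -/
lemma bracket_orbitSum_tmul [Fintype Γ] (x y : 𝔤) (a b : A) :
    LieSuperalgebra.bracket (orbitSum σ τ (x ⊗ₜ a)) (orbitSum σ τ (y ⊗ₜ b))
      = ∑ δ : Γ, orbitSum σ τ (LieSuperalgebra.bracket x (σ.toRep δ y) ⊗ₜ (a * τ δ b)) := by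
  refine Subtype.ext ?_
  change LieSuperalgebra.bracket (orbitSum σ τ (x ⊗ₜ a) : 𝔤 ⊗[ℂ] A) (orbitSum σ τ (y ⊗ₜ b)) = _
  rw [AddSubmonoidClass.coe_finsetSum]
  simp only [coe_orbitSum, map_sum, LinearMap.sum_apply]
  conv_rhs => rw [Finset.sum_comm]
  rw [Finset.sum_comm]
  refine Finset.sum_congr rfl fun γ _ => ?_
  refine (Fintype.sum_equiv (Equiv.mulLeft γ) _ _ fun δ => ?_).symm
  simp [diagonalAction, LieSuperalgebra.bracket, σ.map_bracket]

/-- The equivariant map superalgebra of a perfect Lie superalgebra is perfect if `Γ` acts freely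
on the maximal spectrum. -/
lemma equivariantMap_perfect [Finite Γ]
    (h𝔤 : Submodule.map₂ (LieSuperalgebra.bracket (L := 𝔤)) ⊤ ⊤ = ⊤)
    (hfree : ∀ 𝔪 : MaximalSpectrum A, ∀ γ : Γ,
      Ideal.map (τ γ) 𝔪.asIdeal = 𝔪.asIdeal → γ = 1) :
    Submodule.map₂ (LieSuperalgebra.bracket (L := equivariantMap σ τ)) ⊤ ⊤ = ⊤ := by
  classical
  have := Fintype.ofFinite Γ
  set N := Submodule.map₂ (LieSuperalgebra.bracket (L := equivariantMap σ τ)) ⊤ ⊤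
  obtain ⟨e, he⟩ := exists_productMap_eq_ite τ hfree
  -- The bracket formula is linear in `a ⊗ b`, so it extends to all of `A ⊗ A`; the factor `c` is
  -- absorbed into `a`.
  have h1 : ∀ (x y : 𝔤) (c : A) (e : A ⊗[ℂ] A), ∑ δ : Γ, orbitSum σ τ
      (LieSuperalgebra.bracket x (σ.toRep δ y) ⊗ₜ
        (c * Algebra.TensorProduct.productMap (AlgHom.id ℂ A) (τ δ).toAlgHom e)) ∈ N := by
    intro x y c e
    induction e with
    | zero => simp
    | add e e' h h' =>
      simp only [map_add, mul_add, TensorProduct.tmul_add, Finset.sum_add_distrib]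
      exact N.add_mem h h'
    | tmul a b =>
      have := bracket_orbitSum_tmul σ τ x y (c * a) b
      simp only [mul_assoc] at this
      simp only [Algebra.TensorProduct.productMap_apply_tmul]
      refine Eq.subst (motive := (· ∈ N)) this ?_
      exact Submodule.apply_mem_map₂ _ Submodule.mem_top Submodule.mem_top
  -- For the separating element only the term `δ = 1` survives.
  have h2 : ∀ (x y : 𝔤) (c : A), orbitSum σ τ (LieSuperalgebra.bracket x y ⊗ₜ c) ∈ N := by
    intro x y c
    have := h1 x y c e
    simp only [he] at this
    rw [Finset.sum_eq_single 1 (fun δ _ hδ => by simp [hδ]) (by simp)] at this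
    simpa using this
  have h3 : ∀ (z : 𝔤) (c : A), orbitSum σ τ (z ⊗ₜ c) ∈ N := by
    intro z c
    have hle : Submodule.map₂ (LieSuperalgebra.bracket (L := 𝔤)) ⊤ ⊤ ≤
        N.comap (orbitSum σ τ ∘ₗ (TensorProduct.mk ℂ 𝔤 A).flip c) :=
      Submodule.map₂_le.2 fun x _ y _ => h2 x y c
    exact hle (h𝔤.ge Submodule.mem_top)
  refine top_unique fun l _ => ?_
  obtain ⟨t, rfl⟩ := orbitSum_surjective σ τ l
  induction t with
  | zero => simp
  | add t t' h h' => rw [map_add]; exact N.add_mem (h trivial) (h' trivial)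
  | tmul z c => exact h3 z c

/-- The action of the invariants of `A` on `(𝔤 ⊗ A)^Γ` by multiplication. -/
def invariantsMul : invariants τ →ₐ[ℂ] Module.End ℂ (equivariantMap σ τ) where
  toFun b := ((LinearMap.mulLeft ℂ (b : A)).lTensor 𝔤).restrict fun x hx γ => by
    have h : diagonalAction σ τ γ ∘ₗ (LinearMap.mulLeft ℂ (b : A)).lTensor 𝔤
        = (LinearMap.mulLeft ℂ (b : A)).lTensor 𝔤 ∘ₗ diagonalAction σ τ γ := by
      ext y a
      simp [diagonalAction, b.2 γ]
    have := LinearMap.congr_fun h x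
    simp only [LinearMap.comp_apply, hx γ] at this
    exact this
  map_one' := by ext x; simp
  map_mul' b b' := by
    ext x
    simp only [LinearMap.coe_restrict_apply, MulMemClass.coe_mul, LinearMap.mulLeft_mul,
      LinearMap.lTensor_comp]
    rfl
  map_zero' := by ext x; simp
  map_add' b b' := by
    ext x
    change (LinearMap.mulLeft ℂ ((b : A) + b')).lTensor 𝔤 x.1 = _
    rw [show LinearMap.mulLeft ℂ ((b : A) + b') = LinearMap.mulLeft ℂ (b : A)
      + LinearMap.mulLeft ℂ (b' : A) from map_add (LinearMap.mul ℂ A) _ _, LinearMap.lTensor_add]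
    rfl
  commutes' r := by
    ext x
    change (LinearMap.mulLeft ℂ (algebraMap ℂ A r)).lTensor 𝔤 x.1 = r • x.1
    rw [show LinearMap.mulLeft ℂ (algebraMap ℂ A r) = r • LinearMap.id from
      LinearMap.ext fun a => (Algebra.smul_def r a).symm, LinearMap.lTensor_smul]
    simp

lemma coe_invariantsMul (b : invariants τ) (x : equivariantMap σ τ) :
    (invariantsMul σ τ b x : 𝔤 ⊗[ℂ] A) = (LinearMap.mulLeft ℂ (b : A)).lTensor 𝔤 x := rfl

lemma bracket_invariantsMul_left (b : invariants τ) (x y : equivariantMap σ τ) :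
    LieSuperalgebra.bracket (invariantsMul σ τ b x) y
      = invariantsMul σ τ b (LieSuperalgebra.bracket x y) := by
  refine Subtype.ext ?_
  change LieSuperalgebra.bracket ((LinearMap.mulLeft ℂ (b : A)).lTensor 𝔤 x.1) y.1
    = (LinearMap.mulLeft ℂ (b : A)).lTensor 𝔤 (LieSuperalgebra.bracket x.1 y.1)
  induction x.1 with
  | zero => simp
  | add s t h h' => simp only [map_add, LinearMap.add_apply, h, h']
  | tmul u a =>
    induction y.1 with
    | zero => simp
    | add s t h h' => simp only [map_add, h, h']
    | tmul v c => simp [LieSuperalgebra.bracket, mul_assoc]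

lemma bracket_invariantsMul_right (b : invariants τ) (x y : equivariantMap σ τ) :
    LieSuperalgebra.bracket x (invariantsMul σ τ b y)
      = invariantsMul σ τ b (LieSuperalgebra.bracket x y) := by
  refine Subtype.ext ?_
  change LieSuperalgebra.bracket x.1 ((LinearMap.mulLeft ℂ (b : A)).lTensor 𝔤 y.1)
    = (LinearMap.mulLeft ℂ (b : A)).lTensor 𝔤 (LieSuperalgebra.bracket x.1 y.1)
  induction x.1 with
  | zero => simp
  | add s t h h' => simp only [map_add, LinearMap.add_apply, h, h']
  | tmul u a =>
    induction y.1 with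
    | zero => simp
    | add s t h h' => simp only [map_add, h, h']
    | tmul v c => simp [LieSuperalgebra.bracket, mul_left_comm]

lemma orbitSum_mul_tmul [Fintype Γ] (b : invariants τ) (x : 𝔤) (a : A) :
    orbitSum σ τ (x ⊗ₜ (b * a)) = invariantsMul σ τ b (orbitSum σ τ (x ⊗ₜ a)) := by
  refine Subtype.ext ?_
  rw [coe_invariantsMul, coe_orbitSum, coe_orbitSum, map_sum]
  refine Finset.sum_congr rfl fun γ _ => ?_
  simp [diagonalAction, b.2 γ]

/-- If `K` is a graded ideal of finite codimension in `L = (𝔤 ⊗ A)^Γ`, then so is `[K, K]`. -/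
lemma equivariantMap_finite_quotient_map₂_bracket [Finite Γ] [Algebra.FiniteType ℂ A]
    [FiniteDimensional ℂ 𝔤]
    (hL : Submodule.map₂ (LieSuperalgebra.bracket (L := equivariantMap σ τ)) ⊤ ⊤ = ⊤)
    {K : Submodule ℂ (equivariantMap σ τ)} (hgr : IsGraded K)
    (hK : ∀ x ∈ K, ∀ y, LieSuperalgebra.bracket x y ∈ K)
    [Module.Finite ℂ (equivariantMap σ τ ⧸ K)] :
    Module.Finite ℂ (equivariantMap σ τ ⧸
      Submodule.map₂ (LieSuperalgebra.bracket (L := equivariantMap σ τ)) K K) := by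
  have := Fintype.ofFinite Γ
  set N := Submodule.map₂ (LieSuperalgebra.bracket (L := equivariantMap σ τ)) K K
  set K' := Submodule.map₂ (LieSuperalgebra.bracket (L := equivariantMap σ τ)) K ⊤
  have hK'K : K' ≤ K := Submodule.map₂_le.2 fun x hx y _ => hK x hx y
  have : Module.Finite ℂ (equivariantMap σ τ ⧸ K') :=
    LieSuperalgebra.finite_quotient_map₂_bracket hL hgr
  -- `b[x, y] = [x, by]` with `by` again in `L`. This is the reason for working with `[K, L]`:
  -- stability of `K` itself under invariants is not assumed.
  have hstable : ∀ b, K' ≤ K'.comap (invariantsMul σ τ b) := fun b =>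
    Submodule.map₂_le.2 fun x hx y _ => by
      rw [Submodule.mem_comap, ← bracket_invariantsMul_right]
      exact Submodule.apply_mem_map₂ _ hx Submodule.mem_top
  let J : Set A := {a | ∃ b : invariants τ, b = a ∧ ∀ x, invariantsMul σ τ b x ∈ K'}
  let I := Ideal.span J
  -- If `p` is the minimal polynomial of `b` acting on `L / K'`, then `p(b)` maps `L` into `K'`, so
  -- `p(b)` lies in `J`.
  have hfin : Module.Finite ℂ (A ⧸ I * I) := by
    refine finite_quotient_of_isIntegral_invariants τ _ fun a ha => ?_
    let b : invariants τ := ⟨a, ha⟩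
    let φ := K'.mapQ K' (invariantsMul σ τ b) (hstable b)
    refine isIntegral_quotient_mul_self (minpoly.monic (Algebra.IsIntegral.isIntegral (R := ℂ) φ))
      (Ideal.subset_span ⟨Polynomial.aeval b (minpoly ℂ φ), ?_, fun x => ?_⟩)
    · exact (Polynomial.aeval_algHom_apply (invariants τ).val b _).symm
    · have hq : ∀ p : Polynomial ℂ, K'.mkQ (invariantsMul σ τ (Polynomial.aeval b p) x)
          = Polynomial.aeval φ p (K'.mkQ x) := by
        intro p
        rw [← Polynomial.aeval_algHom_apply]
        induction p using Polynomial.induction_on' generalizing x with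
        | add p q hp hq => simp only [map_add, LinearMap.add_apply, hp, hq]
        | monomial n r =>
          simp only [Polynomial.aeval_monomial, Module.End.mul_apply,
            Module.algebraMap_end_apply, map_smul]
          congr 1
          induction n generalizing x with
          | zero => rfl
          | succ n ih => rw [pow_succ, pow_succ, Module.End.mul_apply, Module.End.mul_apply, ih]; rfl
      refine (Submodule.Quotient.mk_eq_zero K').1 ((hq _).trans ?_)
      rw [minpoly.aeval, LinearMap.zero_apply]
  -- The free factor `a` absorbs the coefficients from `A`, which need not be invariant and so
  -- cannot be moved out of the orbit sum.
  have hJ : ∀ c ∈ I * I, ∀ (a : A) (x : 𝔤), orbitSum σ τ (x ⊗ₜ (c * a)) ∈ N := by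
    intro c hc a x
    rw [Ideal.span_mul_span'] at hc
    induction hc using Submodule.span_induction generalizing a with
    | mem c hc =>
      obtain ⟨_, ⟨b, rfl, hb⟩, _, ⟨b', rfl, hb'⟩, rfl⟩ := hc
      -- Two factors from `J` are needed, one to push each entry of the bracket into `K`: `bb'[x, y]
      -- = [bx, b'y]`.
      have hle : Submodule.map₂ (LieSuperalgebra.bracket (L := equivariantMap σ τ)) ⊤ ⊤ ≤
          N.comap (invariantsMul σ τ b ∘ₗ invariantsMul σ τ b') :=
        Submodule.map₂_le.2 fun x _ y _ => by
          rw [Submodule.mem_comap, LinearMap.comp_apply, ← bracket_invariantsMul_right,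
            ← bracket_invariantsMul_left]
          exact Submodule.apply_mem_map₂ _ (hK'K (hb x)) (hK'K (hb' y))
      have h := hle (hL.ge (Submodule.mem_top (x := orbitSum σ τ (x ⊗ₜ a))))
      rw [Submodule.mem_comap, LinearMap.comp_apply, ← orbitSum_mul_tmul,
        ← orbitSum_mul_tmul] at h
      simpa only [mul_assoc] using h
    | zero => simp
    | add c c' _ _ h h' =>
      rw [add_mul, TensorProduct.tmul_add, map_add]
      exact N.add_mem (h a) (h' a)
    | smul r c _ h =>
      rw [smul_eq_mul, mul_comm r, mul_assoc]
      exact h (r * a)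
  have : Module.Finite ℂ (A ⧸ (I * I).restrictScalars ℂ) := hfin
  obtain ⟨F, hF, hFI⟩ := ((I * I).restrictScalars ℂ).exists_fg_sup_eq_top
  -- Since `A = F + I²` with `F` finite-dimensional, the orbit sums of `𝔤 ⊗ F` span `L` modulo `[K,
  -- K]`.
  refine Module.Finite.quotient_of_sup_eq_top
    ((Submodule.FG.map₂ (TensorProduct.mk ℂ 𝔤 A) Module.Finite.fg_top hF).map (orbitSum σ τ))
    (top_unique fun l _ => ?_)
  obtain ⟨t, rfl⟩ := orbitSum_surjective σ τ l
  induction t with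
  | zero => simp
  | add t t' h h' => rw [map_add]; exact Submodule.add_mem _ (h trivial) (h' trivial)
  | tmul z c =>
    obtain ⟨f, hf, i, hi, rfl⟩ := Submodule.mem_sup.1 (hFI.ge (Submodule.mem_top (x := c)))
    rw [TensorProduct.tmul_add, map_add]
    exact Submodule.add_mem_sup (Submodule.mem_map_of_mem
      (Submodule.apply_mem_map₂ _ Submodule.mem_top hf)) (by simpa using hJ i hi 1 z)

end EquivariantMap

end

theorem mainTheorem11
    {𝔤 A Γ : Type*} [AddCommGroup 𝔤] [Module ℂ 𝔤] [SuperSpace 𝔤] [LieSuperalgebra 𝔤]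
    [FiniteDimensional ℂ 𝔤] (h𝔤 : LieSuperalgebra.IsSimple 𝔤)
    [CommRing A] [Algebra ℂ A] [Algebra.FiniteType ℂ A]
    [CommGroup Γ] [Finite Γ]
    (σ : LieSuperalgebra.GroupAction Γ 𝔤) (τ : Γ →* (A ≃ₐ[ℂ] A))
    (hfree : ∀ 𝔪 : MaximalSpectrum A, ∀ γ : Γ,
      Ideal.map (τ γ) 𝔪.asIdeal = 𝔪.asIdeal → γ = 1)
    {V V' : Type*}
    [AddCommGroup V] [Module ℂ V] [SuperSpace V] [LieSupermodule (equivariantMap σ τ) V]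
    [FiniteDimensional ℂ V] (hV : LieSupermodule.IsIrreducible (equivariantMap σ τ) V)
    [AddCommGroup V'] [Module ℂ V'] [SuperSpace V'] [LieSupermodule (equivariantMap σ τ) V']
    [FiniteDimensional ℂ V'] (hV' : LieSupermodule.IsIrreducible (equivariantMap σ τ) V') :
    FiniteDimensional ℂ (SuperExt₁ (equivariantMap σ τ) V V') := by
  refine SuperExt₁.finiteDimensional_of_finite_quotient (equivariantMap σ τ) V V' ?_
  have := LieSupermodule.finite_quotient_inf_annihilator (equivariantMap σ τ) V V'
  exact equivariantMap_finite_quotient_map₂_bracket σ τ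
    (equivariantMap_perfect σ τ h𝔤.perfect hfree)
    (fun x hx z => ⟨LieSupermodule.isGraded_annihilator x hx.1 z,
      LieSupermodule.isGraded_annihilator x hx.2 z⟩)
    fun x hx y => ⟨LieSupermodule.bracket_mem_annihilator hx.1 y,
      LieSupermodule.bracket_mem_annihilator hx.2 y⟩
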